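/- Let $\Omega\subseteq\mathbb R$ be compact, $m_\Omega=\sup_{\omega\in\Omega}|\omega|$ (with $m_\Omega=0$ if $\Omega=\emptyset$), and let $$\mathrm B(\Omega)=\{f\in L^2(\mathbb R):\ \operatorname{supp}\hat f\subseteq\Omega\},\qquad \hat f(\omega)=\int_{\mathbb R} f(x)e^{-i\omega x}\,dx .$$ Each $f\in\mathrm B(\Omega)$ has a unique continuous representative, and $f(x)$ denotes its values. Let $s\ge 0$ be an integer, $I$ a countable index set, and $\{x_{n,m}\}_{n\in I,\,0\le m\le s}\subseteq\mathbb R$ a bunched sampling set with density $\delta$ and bunch width $h=\tau\delta$, $\tau\in(0,1]$, which means the following. The centres $x_{n,0}$, $n\in I$, are pairwise distinct; every real number has a nearest centre (as is the case when the centres are locally finite), i.e. the Voronoi regions $V_n=\{y\in\mathbb R:\ |y-x_{n,0}|\le|y-x_{k,0}|\ \ \forall k\in I\}$ cover $\mathbb R$; $\delta=\sup_{y\in\mathbb R}\inf_{n\in I}|y-x_{n,0}|<\infty$; for each $n$ the $s+1$ points $x_{n,0},\dots,x_{n,s}$ are pairwise distinct, and there are $h_n\ge 0$ with $x_{n,m}\in[x_{n,0}-h_n,x_{n,0}+h_n]\subseteq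 V_n$ for $0\le m\le s$; and $\sup_{n\in I}h_n=\tau\delta$. For a function $g:\mathbb R\to\mathbb C$ let $p_n(g)$ be the unique polynomial of degree at most $s$ with $p_n(g)(x_{n,m})=g(x_{n,m})$, $m=0,\dots,s$, and put $\mathcal P_n(g)=p_n(g)\,\mathbb 1_{V_n}$. Let $\tilde H_{s,\tau}$ be the inverse function of the bijection $$\tilde h_{s,\tau}:(0,\infty)\to(0,\infty),\qquad \tilde h_{s,\tau}(z)=\frac{(1+\tau)^s z^{s+1}}{(s+1)!}\Bigl(1+\frac{4z}{\pi}\Bigr).$$ **Theorem.** Suppose that $\delta\, m_\Omega<\tilde H_{s,\tau}(1)$ (that is, $\delta<\tilde H_{s,\tau}(1)/m_\Omega$ if $m_\Omega>0$). Then: 1. $\mathcal P_n(\mathcal P_n(g))=\mathcal P_n(g)$ for all $n\in I$ and all $g:\mathbb R\to\mathbb C$, and each $\mathcal P_n$ defines a bounded linear operator $\mathrm B(\Omega)\to L^2(\mathbb R)$. 2. For all $f\in\mathrm B(\Omega)$ the series $\sum_{n\in I}\|\mathcal P_n(f)\|^2$ converges and $$A\|f\|^2\le\sum_{n\in I}\|\mathcal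 P_n(f)\|^2\le B\|f\|^2,$$ where $$A=\left(1-\frac{(1+\tau)^s(\delta m_\Omega)^{s+1}}{(s+1)!}\Bigl(1+\frac{4\delta m_\Omega}{\pi}\Bigr)\right)^2,\qquad B=\left(1+\frac{(1+\tau)^s(\delta m_\Omega)^{s+1}}{(s+1)!}\Bigl(1+\frac{4\delta m_\Omega}{\pi}\Bigr)\right)^2 .$$ 3. $\{\mathcal P_n\}_{n\in I}$ is a non-orthogonal fusion frame for $\mathrm B(\Omega)$ with weights $v_n=1$. That is, the weights are positive; each $\mathcal P_n:\mathrm B(\Omega)\to L^2(\mathbb R)$ is the restriction to $\mathrm B(\Omega)$ of a bounded, not necessarily orthogonal, projection of $L^2(\mathbb R)$ with closed range; and there are constants $A',B'>0$ such that $A'\|f\|^2\le\sum_{n\in I}v_n\|\mathcal P_n(f)\|^2\le B'\|f\|^2$ for all $f\in\mathrm B(\Omega)$, with a convergent sum. -/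

import Mathlib

open MeasureTheory FourierTransform Set

noncomputable section

namespace BunchedSampling

/-- The complex Hilbert space `L²(ℝ)`. -/
abbrev L2 : Type := Lp ℂ 2 (volume : Measure ℝ)

/-! ### Bandlimited functions

Mathlib's Fourier transform on `L²(ℝ)` is normalised as `𝓕 f ξ = ∫ f(x) exp(-2πi x ξ) dx`, so that
the transform with kernel `exp(-i ω x)` is `ω ↦ 𝓕 f (ω / (2π))`. -/

/-- `B(Ω)`: all `f ∈ L²(ℝ)` whose Fourier transform (kernel `exp(-i ω x)`) vanishes almost
everywhere outside `Ω`; for closed `Ω` this says that its support is contained in `Ω`. -/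
def bandlimited (Ω : Set ℝ) : Submodule ℂ L2 where
  carrier := {f | ∀ᵐ ξ : ℝ, 2 * Real.pi * ξ ∉ Ω → (𝓕 f : L2) ξ = 0}
  zero_mem' := by
    have h : (𝓕 (0 : L2) : L2) = 0 := (Lp.fourierTransformₗᵢ ℝ ℂ).map_zero
    rw [mem_ofPred_eq, h]
    filter_upwards [Lp.coeFn_zero ℂ 2 (volume : Measure ℝ)] with ξ hξ _
    simpa only [Pi.zero_apply] using hξ
  add_mem' := by
    intro f g hf hg
    rw [mem_ofPred_eq] at hf hg ⊢
    rw [FourierTransform.fourier_add]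
    filter_upwards [hf, hg, Lp.coeFn_add (𝓕 f : L2) (𝓕 g : L2)] with ξ h1 h2 h3 h4
    rw [h3, Pi.add_apply, h1 h4, h2 h4, add_zero]
  smul_mem' := by
    intro c f hf
    rw [mem_ofPred_eq] at hf ⊢
    rw [FourierTransform.fourier_smul]
    filter_upwards [hf, Lp.coeFn_smul c (𝓕 f : L2)] with ξ h1 h2 h3
    rw [h2, Pi.smul_apply, h1 h3, smul_zero]

/-- The point values `f(x) = ∫ 𝓕 f (ξ) exp(2πi x ξ) dξ`. For `f` in `B(Ω)` with `Ω` compact this is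
the (unique) continuous representative of `f`, see `continuous_pointValue` and
`pointValue_ae_eq`. -/
def pointValue (f : L2) : ℝ → ℂ := 𝓕⁻ (⇑(𝓕 f : L2) : ℝ → ℂ)

theorem integrable_fourier {Ω : Set ℝ} (hΩ : IsCompact Ω) {f : L2} (hf : f ∈ bandlimited Ω) :
    Integrable (⇑(𝓕 f : L2) : ℝ → ℂ) := by
  set K : Set ℝ := (fun ω : ℝ => ω / (2 * Real.pi)) '' Ω with hK
  have hKc : IsCompact K := hΩ.image (by fun_prop)
  have h1 : Integrable (K.indicator (⇑(𝓕 f : L2) : ℝ → ℂ)) := by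
    rw [integrable_indicator_iff hKc.measurableSet]
    have : IsFiniteMeasure (volume.restrict K) := ⟨by
      simpa using hKc.measure_lt_top⟩
    exact ((Lp.memLp (𝓕 f : L2)).restrict K).integrable (by norm_num)
  refine h1.congr ?_
  have hf' : ∀ᵐ ξ : ℝ, 2 * Real.pi * ξ ∉ Ω → (𝓕 f : L2) ξ = 0 := hf
  filter_upwards [hf'] with ξ hξ
  by_cases h : ξ ∈ K
  · rw [indicator_of_mem h]
  · rw [indicator_of_notMem h, hξ]
    intro h2
    exact h ⟨_, h2, by field_simp⟩

theorem continuous_pointValue {Ω : Set ℝ} (hΩ : IsCompact Ω) {f : L2} (hf : f ∈ bandlimited Ω) :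
    Continuous (pointValue f) := by
  have h := integrable_fourier hΩ hf
  have h2 := (Real.Lp.fourierTransformInv ((memLp_one_iff_integrable.2 h).toLp)).continuous
  rwa [Real.Lp.fourierTransformInv_toLp] at h2

theorem pointValue_ae_eq {Ω : Set ℝ} (hΩ : IsCompact Ω) {f : L2} (hf : f ∈ bandlimited Ω) :
    pointValue f =ᵐ[volume] f := by
  have hG := integrable_fourier hΩ hf
  refine ae_eq_of_integral_contDiff_smul_eq
    (continuous_pointValue hΩ hf).locallyIntegrable
    ((Lp.memLp f).locallyIntegrable (by norm_num)) ?_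
  intro g hg hgc
  have hc1 : HasCompactSupport (fun x => (g x : ℂ)) := hgc.comp_left Complex.ofReal_zero
  have hc2 : ContDiff ℝ ((⊤ : ℕ∞) : WithTop ℕ∞) (fun x => (g x : ℂ)) :=
    Complex.ofRealCLM.contDiff.comp hg
  let φ : SchwartzMap ℝ ℂ := hc1.toSchwartzMap hc2
  have hφ : ∀ x, φ x = (g x : ℂ) := fun x => rfl
  have key := DFunLike.congr_fun (Lp.fourier_toTemperedDistribution_eq f) (𝓕⁻ φ)
  rw [TemperedDistribution.fourier_apply, FourierTransform.fourier_fourierInv_eq,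
    Lp.toTemperedDistribution_apply, Lp.toTemperedDistribution_apply] at key
  have e1 : ∫ x, g x • f x = ∫ x, φ x • f x := by
    simp [hφ]
  have e2 : ∫ x, g x • pointValue f x = ∫ x, φ x • pointValue f x := by
    simp [hφ]
  rw [e1, e2, key]
  have e3 : pointValue f = 𝓕 (fun x => (𝓕 f : L2) (-x)) := by
    rw [pointValue, Real.fourierInv_eq_fourier_comp_neg]
  rw [e3]
  have e4 := (VectorFourier.integral_fourierIntegral_smul_eq_flip (L := innerₗ ℝ)
    (μ := volume) (ν := volume) (f := φ) (g := fun x => (𝓕 f : L2) (-x))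
    Real.continuous_fourierChar continuous_inner φ.integrable hG.comp_neg)
  have e5 : ∫ x, φ x • 𝓕 (fun x => (𝓕 f : L2) (-x)) x
      = ∫ x, (𝓕 (φ : ℝ → ℂ)) x • (𝓕 f : L2) (-x) := by
    simpa using! e4.symm
  rw [e5, ← integral_neg_eq_self]
  congr 1
  ext x
  rw [neg_neg, SchwartzMap.fourierInv_coe, Real.fourierInv_eq_fourier_neg]

/-- `m_Ω = sup {|ω| : ω ∈ Ω}` (a supremum of a bounded set for compact `Ω`; `0` if `Ω = ∅`). -/
def bandwidth (Ω : Set ℝ) : ℝ := sSup ((fun ω : ℝ => |ω|) '' Ω)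

/-! ### Bunched sampling sets -/

/-- The (closed) Voronoi region of the point `c n` among the points `c m`. -/
def voronoi {I : Type*} (c : I → ℝ) (n : I) : Set ℝ := {y | ∀ m, |y - c n| ≤ |y - c m|}

/-- `x n m`, `n ∈ I`, `0 ≤ m ≤ s`, is a bunched sampling set with centres `x n 0`, density `δ` and
bunch width `h = τ δ`, where `r n` is the half-width of the `n`-th bunch and `h = sup r n`. -/
structure IsBunchedSamplingSet {I : Type*} {s : ℕ} (x : I → Fin (s + 1) → ℝ) (r : I → ℝ)
    (δ τ : ℝ) : Prop where
  /-- The centres are pairwise distinct. -/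
  centre_injective : Function.Injective fun n => x n 0
  /-- Every real number has a nearest centre, i.e. the Voronoi regions cover the line. -/
  exists_nearest : ∀ y : ℝ, ∃ n, y ∈ voronoi (fun k => x k 0) n
  /-- `δ = sup_y inf_n |y - x n 0|`, and this supremum is finite. -/
  density : IsLUB (range fun y : ℝ => ⨅ n, |y - x n 0|) δ
  /-- The `s + 1` points of a bunch are pairwise distinct. -/
  node_injective : ∀ n, Function.Injective (x n)
  radius_nonneg : ∀ n, 0 ≤ r n
  node_mem : ∀ n m, x n m ∈ Icc (x n 0 - r n) (x n 0 + r n)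
  subset_voronoi : ∀ n, Icc (x n 0 - r n) (x n 0 + r n) ⊆ voronoi (fun k => x k 0) n
  width : IsLUB (range r) (τ * δ)

/-! ### Interpolation on the bunches -/

/-- The polynomial of degree at most `s` that takes the value `g (p m)` at `p m`, `0 ≤ m ≤ s`. -/
def interpPoly {s : ℕ} (p : Fin (s + 1) → ℝ) (g : ℝ → ℂ) : Polynomial ℂ :=
  Lagrange.interpolate Finset.univ (fun m => ((p m : ℝ) : ℂ)) fun m => g (p m)

/-- Interpolation in the `n`-th bunch, cut off to the Voronoi region of its centre. -/
def bunchInterp {I : Type*} {s : ℕ} (x : I → Fin (s + 1) → ℝ) (n : I) (g : ℝ → ℂ) : ℝ → ℂ :=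
  (voronoi (fun k => x k 0) n).indicator fun y => (interpPoly (x n) g).eval (y : ℂ)

/-! ### Fusion frames -/

/-- `A ‖f‖² ≤ ∑ v n ‖P n f‖² ≤ B ‖f‖²` for all `f ∈ H`, with a convergent sum. -/
def HasFusionBounds {K : Type*} [NormedAddCommGroup K] [InnerProductSpace ℂ K] {I : Type*}
    {H : Submodule ℂ K} (v : I → ℝ) (P : I → H →L[ℂ] K) (A B : ℝ) : Prop :=
  ∀ f : H, Summable (fun n => v n * ‖P n f‖ ^ 2) ∧
    A * ‖f‖ ^ 2 ≤ ∑' n, v n * ‖P n f‖ ^ 2 ∧ ∑' n, v n * ‖P n f‖ ^ 2 ≤ B * ‖f‖ ^ 2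

/-- `P n` (with weights `v n`) is a non-orthogonal fusion frame for the subspace `H` of the Hilbert
space `K`: the weights are positive, every `P n : H → K` is the restriction to `H` of a bounded, not
necessarily orthogonal, projection of `K` with closed range, and the frame inequality holds with
positive bounds. For `H = ⊤` the `P n` are thus projections of the Hilbert space itself. -/
structure IsNonorthogonalFusionFrame {K : Type*} [NormedAddCommGroup K] [InnerProductSpace ℂ K]
    {I : Type*} {H : Submodule ℂ K} (v : I → ℝ) (P : I → H →L[ℂ] K) : Prop where
  weight_pos : ∀ n, 0 < v n
  projection : ∀ n, ∃ Q : K →L[ℂ] K, (∀ g, Q (Q g) = Q g) ∧ IsClosed (range Q) ∧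
    ∀ f : H, Q f = P n f
  bounds : ∃ A B : ℝ, 0 < A ∧ 0 < B ∧ HasFusionBounds v P A B

/-! ### The density bound -/

/-- `(1 + τ)^s z^(s+1) / (s+1)! * (1 + 4 z / π)`. -/
def hTilde (s : ℕ) (τ z : ℝ) : ℝ :=
  (1 + τ) ^ s * z ^ (s + 1) / ((s + 1).factorial : ℝ) * (1 + 4 * z / Real.pi)

theorem bijOn_hTilde (s : ℕ) {τ : ℝ} (hτ : 0 < τ) : BijOn (hTilde s τ) (Ioi 0) (Ioi 0) := by
  have hp := Real.pi_pos
  have hF : (0 : ℝ) < ((s + 1).factorial : ℝ) := by positivity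
  have hF1 : (1 : ℝ) ≤ ((s + 1).factorial : ℝ) := by
    exact_mod_cast Nat.succ_le_of_lt (Nat.factorial_pos _)
  refine ⟨?_, ?_, ?_⟩
  · intro z hz
    have hz : 0 < z := hz
    have : 0 < hTilde s τ z := by unfold hTilde; positivity
    exact this
  · refine StrictMonoOn.injOn ?_
    intro a ha b hb hab
    have ha : 0 < a := ha
    have hb : 0 < b := hb
    unfold hTilde
    gcongr
  · intro w hw
    have hw : 0 < w := hw
    set b : ℝ := max 1 (((s + 1).factorial : ℝ) * w) with hbdef
    have hb1 : 1 ≤ b := le_max_left _ _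
    have hb0 : 0 < b := by linarith
    have hbw : ((s + 1).factorial : ℝ) * w ≤ b := le_max_right _ _
    have h0 : hTilde s τ 0 = 0 := by simp [hTilde]
    have hb : w < hTilde s τ b := by
      have h1 : (1 : ℝ) ≤ (1 + τ) ^ s := one_le_pow₀ (by linarith)
      have h2 : b ≤ b ^ (s + 1) := le_self_pow₀ hb1 (by omega)
      have h3 : (1 : ℝ) < 1 + 4 * b / Real.pi := by
        have : 0 < 4 * b / Real.pi := by positivity
        linarith
      have h4 : w ≤ (1 + τ) ^ s * b ^ (s + 1) / ((s + 1).factorial : ℝ) := by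
        rw [le_div_iff₀ hF]
        nlinarith [pow_pos hb0 (s + 1)]
      have h5 : 0 < (1 + τ) ^ s * b ^ (s + 1) / ((s + 1).factorial : ℝ) := by positivity
      unfold hTilde
      nlinarith
    have hc : ContinuousOn (hTilde s τ) (Icc 0 b) := by
      unfold hTilde
      fun_prop
    obtain ⟨z, hz, hzw⟩ := intermediate_value_Ioo hb0.le hc (show w ∈ Ioo _ _ from ⟨by rwa [h0], hb⟩)
    exact ⟨z, hz.1, hzw⟩

/-- The inverse function of `hTilde s τ : (0, ∞) → (0, ∞)`. -/
def HTilde (s : ℕ) (τ w : ℝ) : ℝ := Function.invFunOn (hTilde s τ) (Ioi 0) w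

end BunchedSampling

end

namespace BunchedSampling

/-! The frame bounds say that f ↦ (‖P_n f‖)_n is nearly an isometry into ℓ²(I). Since the Voronoi
cells tile the line up to null sets, ‖f‖² is the sum of the squared L²(V_n) norms of f, so by the
triangle inequality in each L²(V_n) and then in ℓ² it suffices to control the interpolation error
cell by cell.

On V_n the Lagrange remainder (`norm_sub_interpPoly_le`) bounds the error by max|f^(s+1)| / (s+1)!
times the product of distances to the nodes, which is at most δ · ((1+τ)δ)^s. The maximum is
attained at some ξ in V_n, and the L²(V_n) norm of the constant f^(s+1)(ξ) is at most that of
f^(s+1) plus that of f^(s+1) - f^(s+1)(ξ). The latter vanishes at ξ, so the sharp Wirtinger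
inequality on an interval of length at most 2δ bounds it by 4δ/π times the norm of f^(s+2)
(`lpNorm_sub_interpPoly_le`). Summing in ℓ² and applying Bernstein's inequality gives a deviation of
at most η‖f‖ with η = `hTilde s τ (δ * bandwidth Ω)`, and the density hypothesis is exactly what
makes η < 1.

For the projection property, P_n takes values in a finite-dimensional space W of functions supported
in V_n. A bandlimited function vanishing outside a bounded interval is zero, so W meets B(Ω)
trivially, and the map that is P_n on B(Ω) and the identity on W extends to a bounded projection of
L² (`exists_projection_extending`). -/

/-! ### Bandlimited functions: Bernstein's inequality, point evaluation, closedness -/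

theorem bandwidth_nonneg (Ω : Set ℝ) : 0 ≤ bandwidth Ω :=
  Real.sSup_nonneg (by rintro _ ⟨ω, _, rfl⟩; exact abs_nonneg ω)

theorem abs_le_bandwidth {Ω : Set ℝ} (hΩ : IsCompact Ω) {ω : ℝ} (hω : ω ∈ Ω) :
    |ω| ≤ bandwidth Ω :=
  le_csSup (hΩ.image continuous_abs).bddAbove (mem_image_of_mem _ hω)

/-- `B(Ω)` is stable under differentiation, with Bernstein's bound for the norm. -/
theorem exists_derivative {Ω : Set ℝ} (hΩ : IsCompact Ω) {f : L2} (hf : f ∈ bandlimited Ω) :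
    ∃ f' ∈ bandlimited Ω, (∀ x, HasDerivAt (pointValue f) (pointValue f' x) x) ∧
      ‖f'‖ ≤ bandwidth Ω * ‖f‖ := by
  set G : ℝ → ℂ := ⇑(𝓕 f : L2) with hG
  -- The derivative is defined on the Fourier side as the multiplier 2πiξ, whose modulus is at most
  -- m_Ω wherever 2πξ lies in Ω; Plancherel then gives Bernstein's bound.
  set g : ℝ → ℂ := fun ξ => (2 * Real.pi * Complex.I * ξ) * G ξ with hg
  have hf' : ∀ᵐ ξ : ℝ, 2 * Real.pi * ξ ∉ Ω → G ξ = 0 := hf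
  have hGm : MemLp G 2 volume := Lp.memLp _
  have hgm : AEStronglyMeasurable g volume :=
    (Continuous.aestronglyMeasurable (by fun_prop)).mul hGm.1
  have hle : ∀ᵐ ξ : ℝ, ‖g ξ‖ ≤ bandwidth Ω * ‖G ξ‖ := by
    filter_upwards [hf'] with ξ hξ
    by_cases h : 2 * Real.pi * ξ ∈ Ω
    · have h1 := abs_le_bandwidth hΩ h
      have h2 : ‖g ξ‖ = |2 * Real.pi * ξ| * ‖G ξ‖ := by
        simp [hg, abs_mul]
      rw [h2]
      gcongr
    · simp [hg, hξ h]
  have hg2 : MemLp g 2 volume := hGm.of_le_mul hgm hle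
  set f' : L2 := 𝓕⁻ (hg2.toLp g) with hf'def
  have hFf' : (𝓕 f' : L2) = hg2.toLp g := FourierTransform.fourier_fourierInv_eq _
  have hae : (⇑(𝓕 f' : L2) : ℝ → ℂ) =ᵐ[volume] g := by rw [hFf']; exact hg2.coeFn_toLp
  have hmem : f' ∈ bandlimited Ω := by
    change ∀ᵐ ξ : ℝ, 2 * Real.pi * ξ ∉ Ω → (𝓕 f' : L2) ξ = 0
    filter_upwards [hf', hae] with ξ h1 h2 h3
    rw [h2, hg]
    simp [h1 h3]
  have hGi : Integrable G := integrable_fourier hΩ hf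
  have hgi : Integrable g := (integrable_fourier hΩ hmem).congr hae
  refine ⟨f', hmem, fun x => ?_, ?_⟩
  · have e1 : pointValue f' x = 𝓕⁻ g x := Real.fourierInv_congr_ae hae x
    have e2 : pointValue f = 𝓕 (fun ξ => G (-ξ)) := Real.fourierInv_eq_fourier_comp_neg G
    have hxi : Integrable (fun ξ : ℝ => ξ • G (-ξ)) := by
      have h1 := (hgi.comp_neg).const_mul (-(2 * Real.pi * Complex.I)⁻¹)
      refine h1.congr (Filter.Eventually.of_forall fun ξ => ?_)
      have : (2 * Real.pi * Complex.I : ℂ) ≠ 0 := by simp [Real.pi_ne_zero]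
      simp only [hg, Complex.real_smul]
      push_cast
      field_simp
    have h := Real.hasDerivAt_fourier hGi.comp_neg hxi x
    rw [e1, e2, Real.fourierInv_eq_fourier_comp_neg]
    convert! h using 3 with ξ
    simp only [hg, smul_eq_mul]
    push_cast
    ring
  · rw [← Lp.norm_fourier_eq f', ← Lp.norm_fourier_eq f]
    refine Lp.norm_le_mul_norm_of_ae_le_mul ?_
    filter_upwards [hae, hle] with ξ h1 h2
    rw [h1]
    exact h2

theorem pointValue_add {Ω : Set ℝ} (hΩ : IsCompact Ω) {f g : L2} (hf : f ∈ bandlimited Ω)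
    (hg : g ∈ bandlimited Ω) (x : ℝ) :
    pointValue (f + g) x = pointValue f x + pointValue g x := by
  have h := Continuous.ae_eq_iff_eq volume
    (continuous_pointValue hΩ (Submodule.add_mem _ hf hg))
    ((continuous_pointValue hΩ hf).add (continuous_pointValue hΩ hg))
  refine congrFun (h.1 ?_) x
  filter_upwards [pointValue_ae_eq hΩ (Submodule.add_mem _ hf hg), pointValue_ae_eq hΩ hf,
    pointValue_ae_eq hΩ hg, Lp.coeFn_add f g] with y h1 h2 h3 h4
  rw [h1, h4, Pi.add_apply, Pi.add_apply, h2, h3]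

theorem pointValue_smul {Ω : Set ℝ} (hΩ : IsCompact Ω) {f : L2} (hf : f ∈ bandlimited Ω)
    (c : ℂ) (x : ℝ) : pointValue (c • f) x = c * pointValue f x := by
  have h := Continuous.ae_eq_iff_eq volume
    (continuous_pointValue hΩ (Submodule.smul_mem _ c hf))
    (continuous_const.mul (continuous_pointValue hΩ hf) : Continuous fun y => c * pointValue f y)
  refine congrFun (h.1 ?_) x
  filter_upwards [pointValue_ae_eq hΩ (Submodule.smul_mem _ c hf), pointValue_ae_eq hΩ hf,
    Lp.coeFn_smul c f] with y h1 h2 h3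
  simp [h1, h2, h3]

/-- Cauchy–Schwarz on the Fourier side: the transform lives on the compact set K = Ω/(2π), so its L¹
norm is at most |K|^(1/2) times its L² norm. This makes point evaluations bounded. -/
theorem exists_norm_pointValue_le {Ω : Set ℝ} (hΩ : IsCompact Ω) :
    ∃ C : ℝ, 0 ≤ C ∧ ∀ f ∈ bandlimited Ω, ∀ x, ‖pointValue f x‖ ≤ C * ‖f‖ := by
  set K : Set ℝ := (fun ω : ℝ => ω / (2 * Real.pi)) '' Ω with hK
  have hKc : IsCompact K := hΩ.image (by fun_prop)
  refine ⟨(volume K ^ (1 / 2 : ℝ)).toReal, ENNReal.toReal_nonneg, fun f hf x => ?_⟩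
  set G : ℝ → ℂ := ⇑(𝓕 f : L2) with hG
  have hf' : ∀ᵐ ξ : ℝ, 2 * Real.pi * ξ ∉ Ω → G ξ = 0 := hf
  have hGm : MemLp G 2 volume := Lp.memLp _
  have hGi : Integrable G := integrable_fourier hΩ hf
  have hKG : K.indicator G =ᵐ[volume] G := by
    filter_upwards [hf'] with ξ hξ
    by_cases h : ξ ∈ K
    · rw [indicator_of_mem h]
    · rw [indicator_of_notMem h, hξ]
      intro h2
      exact h ⟨_, h2, by field_simp⟩
  have h1 : ‖pointValue f x‖ ≤ ∫ ξ, ‖G ξ‖ :=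
    VectorFourier.norm_fourierIntegral_le_integral_norm Real.fourierChar volume (-innerₗ ℝ) G x
  have h2 : eLpNorm G 1 volume ≤ eLpNorm G 2 volume * volume K ^ (1 / 2 : ℝ) := by
    rw [← eLpNorm_congr_ae hKG, eLpNorm_indicator_eq_eLpNorm_restrict hKc.measurableSet]
    refine (eLpNorm_le_eLpNorm_mul_rpow_measure_univ (q := 2) (by norm_num)
      hGm.1.restrict).trans ?_
    rw [Measure.restrict_apply_univ]
    norm_num
    gcongr
    exact Measure.restrict_le_self
  have h3 : (∫ ξ, ‖G ξ‖) = (eLpNorm G 1 volume).toReal := by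
    rw [toReal_eLpNorm hGi.1, lpNorm_one_eq_integral_norm hGi.1]
  have h4 : ‖f‖ = (eLpNorm G 2 volume).toReal := by
    rw [← Lp.norm_fourier_eq f, Lp.norm_def]
  rw [h3] at h1
  refine h1.trans ?_
  rw [h4, mul_comm, ← ENNReal.toReal_mul]
  refine ENNReal.toReal_mono (ENNReal.mul_ne_top hGm.2.ne ?_) h2
  exact ENNReal.rpow_ne_top_of_nonneg (by norm_num) hKc.measure_ne_top

/-- B(Ω) is the kernel of a continuous map, the Fourier transform followed by restriction to the
complement of Ω/(2π). Closedness supplies the orthogonal projection onto B(Ω). -/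
theorem isClosed_bandlimited {Ω : Set ℝ} (hΩ : IsCompact Ω) :
    IsClosed (bandlimited Ω : Set L2) := by
  set S : Set ℝ := {ξ | 2 * Real.pi * ξ ∉ Ω} with hS
  have hSm : MeasurableSet S :=
    (hΩ.isClosed.isOpen_compl.preimage (by fun_prop : Continuous fun ξ : ℝ =>
      2 * Real.pi * ξ)).measurableSet
  set T := LpToLpRestrictCLM ℝ ℂ ℂ volume 2 S
  have hc : Continuous fun f : L2 => T (𝓕 f : L2) :=
    T.continuous.comp (ContinuousFourier.continuous_fourier)
  convert isClosed_singleton (x := (0 : Lp ℂ 2 (volume.restrict S))) |>.preimage hc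
  ext f
  change (∀ᵐ ξ : ℝ, 2 * Real.pi * ξ ∉ Ω → (𝓕 f : L2) ξ = 0) ↔ T (𝓕 f : L2) = 0
  rw [Lp.eq_zero_iff_ae_eq_zero]
  have h1 : (⇑(T (𝓕 f : L2)) : ℝ → ℂ) =ᵐ[volume.restrict S] (𝓕 f : L2) :=
    LpToLpRestrictCLM_coeFn ℂ S _
  rw [show ((⇑(T (𝓕 f : L2)) : ℝ → ℂ) =ᵐ[volume.restrict S] 0) ↔
    ((⇑(𝓕 f : L2) : ℝ → ℂ) =ᵐ[volume.restrict S] 0) from ⟨h1.symm.trans, h1.trans⟩]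
  exact (ae_restrict_iff' hSm).symm

/-- The chain of all derivatives of an element of `B(Ω)`. -/
theorem exists_derivatives {Ω : Set ℝ} (hΩ : IsCompact Ω) {f : L2} (hf : f ∈ bandlimited Ω) :
    ∃ F : ℕ → L2, F 0 = f ∧ (∀ k, F k ∈ bandlimited Ω) ∧
      (∀ k x, HasDerivAt (pointValue (F k)) (pointValue (F (k + 1)) x) x) ∧
      ∀ k, ‖F k‖ ≤ bandwidth Ω ^ k * ‖f‖ := by
  choose D hD1 hD2 hD3 using fun f : bandlimited Ω => exists_derivative hΩ f.2
  set E : bandlimited Ω → bandlimited Ω := fun f => ⟨D f, hD1 f⟩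
  have hE : ∀ k, E^[k + 1] ⟨f, hf⟩ = E (E^[k] ⟨f, hf⟩) := fun k =>
    Function.iterate_succ_apply' _ _ _
  refine ⟨fun k => (E^[k] ⟨f, hf⟩ : bandlimited Ω), rfl, fun k => Subtype.coe_prop _,
    fun k x => ?_, fun k => ?_⟩
  · beta_reduce
    rw [hE]
    exact hD2 _ x
  · induction k with
    | zero => simp
    | succ k ih =>
      beta_reduce at ih ⊢
      rw [hE, pow_succ', mul_assoc]
      exact (hD3 _).trans (mul_le_mul_of_nonneg_left ih (bandwidth_nonneg Ω))

/-! ### Uniqueness for functions with geometrically bounded derivatives -/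

/-- Taylor's estimate at a point where all derivatives vanish: integrate the bound for the next
derivative along the segment from a to x. As n grows the bound tends to 0, which replaces an appeal
to analyticity. -/
theorem norm_le_of_derivatives_eq_zero {F : ℕ → ℝ → ℂ} {C m a : ℝ}
    (hF : ∀ k x, HasDerivAt (F k) (F (k + 1) x) x) (hb : ∀ k x, ‖F k x‖ ≤ C * m ^ k)
    (ha : ∀ k, F k a = 0) (x : ℝ) (n k : ℕ) :
    ‖F k x‖ ≤ C * m ^ (k + n) * |x - a| ^ n / n.factorial := by
  induction n generalizing k x with
  | zero => simpa using hb k x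
  | succ n ih =>
    -- At a + t(x - a) the induction hypothesis for F (k + 1), times the chain-rule factor |x - a|,
    -- is D tⁿ/n!, the derivative of D tⁿ⁺¹/(n+1)!.
    set D : ℝ := C * m ^ (k + 1 + n) * |x - a| ^ (n + 1) with hD
    have hu : ∀ t : ℝ, HasDerivAt (fun t : ℝ => F k (a + t * (x - a)))
        ((x - a) • F (k + 1) (a + t * (x - a))) t := by
      intro t
      refine (hF k _).scomp t ?_
      simpa using ((hasDerivAt_id t).mul_const (x - a)).const_add a
    have hB : ∀ t : ℝ, HasDerivAt (fun t : ℝ => D * t ^ (n + 1) / (n + 1).factorial)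
        (D * t ^ n / n.factorial) t := by
      intro t
      refine (((hasDerivAt_pow (n + 1) t).const_mul D).div_const
        ((n + 1).factorial : ℝ)).congr_deriv ?_
      rw [Nat.factorial_succ]
      push_cast
      field_simp
    have h := image_norm_le_of_norm_deriv_right_le_deriv_boundary (a := 0) (b := 1)
      (fun t _ => (hu t).continuousAt.continuousWithinAt) (fun t _ => (hu t).hasDerivWithinAt)
      (B := fun t : ℝ => D * t ^ (n + 1) / (n + 1).factorial) (by simp [ha]) hB ?_
      (right_mem_Icc.2 zero_le_one)
    · simpa [hD, add_assoc, add_comm 1 n] using h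
    · intro t ht
      rw [norm_smul, Real.norm_eq_abs]
      refine (mul_le_mul_of_nonneg_left (ih (a + t * (x - a)) (k + 1)) (abs_nonneg _)).trans_eq ?_
      rw [add_sub_cancel_left, abs_mul, abs_of_nonneg ht.1, mul_pow, hD]
      ring

/-- A bandlimited function that vanishes on a nonempty open set is zero. -/
theorem eq_zero_of_pointValue_eq_zero {Ω : Set ℝ} (hΩ : IsCompact Ω) {f : L2}
    (hf : f ∈ bandlimited Ω) {U : Set ℝ} (hU : IsOpen U) (hne : U.Nonempty)
    (h0 : ∀ x ∈ U, pointValue f x = 0) : f = 0 := by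
  obtain ⟨F, hF0, hFm, hFd, hFn⟩ := exists_derivatives hΩ hf
  obtain ⟨C, hC0, hC⟩ := exists_norm_pointValue_le hΩ
  obtain ⟨a, ha⟩ := hne
  have hz : ∀ k, ∀ x ∈ U, pointValue (F k) x = 0 := by
    intro k
    induction k with
    | zero => rwa [hF0]
    | succ k ih =>
      intro x hx
      have h1 : pointValue (F k) =ᶠ[nhds x] fun _ => 0 := by
        filter_upwards [hU.mem_nhds hx] with y hy using ih y hy
      exact ((hFd k x).congr_of_eventuallyEq h1.symm).unique (hasDerivAt_const x 0)
  have hx : ∀ x, pointValue f x = 0 := by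
    intro x
    have h1 : ∀ n : ℕ, ‖pointValue f x‖ ≤
        C * ‖f‖ * ((bandwidth Ω * |x - a|) ^ n / n.factorial) := by
      intro n
      have := norm_le_of_derivatives_eq_zero (C := C * ‖f‖) (m := bandwidth Ω) hFd
        (fun k x => (hC _ (hFm k) x).trans (by
          have := mul_le_mul_of_nonneg_left (hFn k) hC0
          linarith)) (fun k => hz k a ha) x n 0
      rw [hF0, zero_add] at this
      refine this.trans_eq ?_
      rw [mul_pow]
      ring
    have h2 := (FloorSemiring.tendsto_pow_div_factorial_atTop (bandwidth Ω * |x - a|)).const_mul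
      (C * ‖f‖)
    rw [mul_zero] at h2
    exact norm_le_zero_iff.1 (ge_of_tendsto' h2 h1)
  rw [Lp.eq_zero_iff_ae_eq_zero]
  filter_upwards [pointValue_ae_eq hΩ hf] with y hy
  rw [← hy, hx]; rfl

/-! ### Lagrange interpolation and its remainder -/

/-- Rolle's theorem for the `n`-th derivative of a function with `n + 1` zeros. -/
theorem exists_iterated_rolle (n : ℕ) {φ : ℕ → ℝ → ℝ} {a b : ℝ}
    (hφ : ∀ k t, HasDerivAt (φ k) (φ (k + 1) t) t) (z : Fin (n + 1) → ℝ) (hz : StrictMono z)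
    (hab : ∀ i, z i ∈ Icc a b) (h0 : ∀ i, φ 0 (z i) = 0) : ∃ ξ ∈ Icc a b, φ n ξ = 0 := by
  induction n generalizing φ with
  | zero => exact ⟨z 0, hab 0, h0 0⟩
  | succ n ih =>
    have hw : ∀ i : Fin (n + 1), ∃ w ∈ Ioo (z i.castSucc) (z i.succ), φ 1 w = 0 := fun i =>
      exists_hasDerivAt_eq_zero (hz (Fin.castSucc_lt_succ))
        (fun t _ => (hφ 0 t).continuousAt.continuousWithinAt) (by rw [h0, h0])
        fun t _ => hφ 0 t
    choose w hw1 hw2 using hw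
    refine ih (φ := fun k => φ (k + 1)) (fun k t => hφ (k + 1) t) w ?_ ?_ hw2
    · cases n with
      | zero => exact fun i j h => absurd h (by omega)
      | succ n =>
        refine Fin.strictMono_iff_lt_succ.2 fun i => ?_
        have h1 := (hw1 i.castSucc).2
        have h2 := (hw1 i.succ).1
        rw [← Fin.succ_castSucc] at h2
        exact h1.trans h2
    · exact fun i => ⟨(hab _).1.trans (hw1 i).1.le, (hw1 i).2.le.trans (hab _).2⟩

theorem exists_iterated_rolle_finset {n : ℕ} {φ : ℕ → ℝ → ℝ} {a b : ℝ}
    (hφ : ∀ k t, HasDerivAt (φ k) (φ (k + 1) t) t) (Z : Finset ℝ) (hZ : Z.card = n + 1)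
    (hab : ∀ t ∈ Z, t ∈ Icc a b) (h0 : ∀ t ∈ Z, φ 0 t = 0) : ∃ ξ ∈ Icc a b, φ n ξ = 0 :=
  exists_iterated_rolle n hφ (Z.orderEmbOfFin hZ) (Z.orderEmbOfFin hZ).strictMono
    (fun i => hab _ (Z.orderEmbOfFin_mem hZ i)) fun i => h0 _ (Z.orderEmbOfFin_mem hZ i)

theorem eval_interpPoly_node {s : ℕ} {p : Fin (s + 1) → ℝ} (hp : Function.Injective p)
    (g : ℝ → ℂ) (m : Fin (s + 1)) : (interpPoly p g).eval ((p m : ℝ) : ℂ) = g (p m) :=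
  Lagrange.eval_interpolate_at_node (v := fun m => ((p m : ℝ) : ℂ)) (fun m => g (p m))
    ((Complex.ofReal_injective.comp hp).injOn) (Finset.mem_univ m)

theorem degree_interpPoly_lt {s : ℕ} {p : Fin (s + 1) → ℝ} (hp : Function.Injective p)
    (g : ℝ → ℂ) : (interpPoly p g).degree < (s + 1 : ℕ) := by
  have := Lagrange.degree_interpolate_lt (s := Finset.univ) (v := fun m => ((p m : ℝ) : ℂ))
    (fun m => g (p m)) ((Complex.ofReal_injective.comp hp).injOn)
  rwa [Finset.card_univ, Fintype.card_fin] at this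

/-- The Lagrange error estimate for complex valued functions; `F k` is the `k`-th derivative. -/
theorem norm_sub_interpPoly_le {s : ℕ} {p : Fin (s + 1) → ℝ} (hp : Function.Injective p)
    {F : ℕ → ℝ → ℂ} (hF : ∀ k x, HasDerivAt (F k) (F (k + 1) x) x) {a b y M : ℝ}
    (hpm : ∀ m, p m ∈ Icc a b) (hy : y ∈ Icc a b) (hM : ∀ ξ ∈ Icc a b, ‖F (s + 1) ξ‖ ≤ M) :
    ‖F 0 y - (interpPoly p (F 0)).eval (y : ℂ)‖ ≤
      M / (s + 1).factorial * ∏ m, |y - p m| := by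
  by_cases hyp : ∃ m, p m = y
  · obtain ⟨m, rfl⟩ := hyp
    rw [eval_interpPoly_node hp, sub_self, norm_zero, Finset.prod_eq_zero (Finset.mem_univ m)]
    · simp
    · simp
  · push Not at hyp
    set v : Fin (s + 1) → ℂ := fun m => ((p m : ℝ) : ℂ) with hv
    set W : Polynomial ℂ := Lagrange.nodal Finset.univ v with hW
    have hWy : W.eval (y : ℂ) ≠ 0 := Lagrange.eval_nodal_not_at_node fun i _ h =>
      hyp i (Complex.ofReal_injective h).symm
    -- K is chosen so that q below also agrees with F 0 at y. Then F 0 - q has s + 2 zeros, and the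
    -- (s+1)-st derivative of q is the constant (s+1)! K.
    set K : ℂ := (F 0 y - (interpPoly p (F 0)).eval (y : ℂ)) / W.eval (y : ℂ) with hK
    set q : Polynomial ℂ := interpPoly p (F 0) + Polynomial.C K * W with hq
    have hqy : q.eval (y : ℂ) = F 0 y := by
      simp [hq, hK, div_mul_cancel₀ _ hWy]
    have hqm : ∀ m, q.eval ((p m : ℝ) : ℂ) = F 0 (p m) := by
      intro m
      have : W.eval (v m) = 0 := Lagrange.eval_nodal_at_node (Finset.mem_univ m)
      simp only [hv] at this
      simp [hq, eval_interpPoly_node hp, this]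
    have hWdeg : W.natDegree = s + 1 := by
      rw [hW, Lagrange.natDegree_nodal]; simp
    have hWc : W.coeff (s + 1) = 1 := by
      rw [← hWdeg]; exact Lagrange.nodal_monic
    have hqc : q.coeff (s + 1) = K := by
      rw [hq, Polynomial.coeff_add, Polynomial.coeff_C_mul, hWc,
        Polynomial.coeff_eq_zero_of_degree_lt (degree_interpPoly_lt hp _)]
      ring
    have hqd : q.natDegree ≤ s + 1 := by
      refine Polynomial.natDegree_add_le_of_degree_le
        (Polynomial.natDegree_le_of_degree_le (degree_interpPoly_lt hp _).le) ?_
      exact (Polynomial.natDegree_C_mul_le _ _).trans hWdeg.le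
    have hder : Polynomial.derivative^[s + 1] q = Polynomial.C (((s + 1).factorial : ℂ) * K) := by
      rw [Polynomial.eq_C_of_natDegree_le_zero (p := Polynomial.derivative^[s + 1] q)
        ((Polynomial.natDegree_iterate_derivative q _).trans (by omega)),
        Polynomial.coeff_iterate_derivative, zero_add, hqc, Nat.descFactorial_self,
        nsmul_eq_mul]
    -- Rolle's theorem needs a real function. Rotating K onto the nonnegative axis before taking
    -- real parts keeps the real-valued constant, which treating real and imaginary parts separately
    -- would lose.
    obtain ⟨c, hc1, hc2⟩ : ∃ c : ℂ, ‖c‖ = 1 ∧ c * K = ‖K‖ := by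
      by_cases h : K = 0
      · exact ⟨1, by simp, by simp [h]⟩
      · refine ⟨‖K‖ / K, by simp [h], by field_simp⟩
    set φ : ℕ → ℝ → ℝ := fun k t =>
      (c * (F k t - (Polynomial.derivative^[k] q).eval (t : ℂ))).re with hφdef
    have hφ : ∀ k t, HasDerivAt (φ k) (φ (k + 1) t) t := by
      intro k t
      have h1 : HasDerivAt (fun t : ℝ => (Polynomial.derivative^[k] q).eval (t : ℂ))
          ((Polynomial.derivative^[k + 1] q).eval (t : ℂ)) t := by
        rw [Function.iterate_succ_apply']
        exact ((Polynomial.derivative^[k] q).hasDerivAt (t : ℂ)).comp_ofReal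
      have h2 := ((hF k t).sub h1).const_mul c
      exact Complex.reCLM.hasFDerivAt.comp_hasDerivAt t h2
    set Z : Finset ℝ := insert y (Finset.univ.image p) with hZ
    have hZc : Z.card = s + 1 + 1 := by
      rw [hZ, Finset.card_insert_of_notMem (by simpa using hyp),
        Finset.card_image_of_injective _ hp]
      simp
    obtain ⟨ξ, hξ, hξ0⟩ := exists_iterated_rolle_finset hφ Z hZc (a := a) (b := b)
      (by
        intro t ht
        rcases Finset.mem_insert.1 ht with rfl | ht
        · exact hy
        · obtain ⟨m, _, rfl⟩ := Finset.mem_image.1 ht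
          exact hpm m)
      (by
        intro t ht
        rcases Finset.mem_insert.1 ht with rfl | ht
        · simp [hφdef, hqy]
        · obtain ⟨m, _, rfl⟩ := Finset.mem_image.1 ht
          simp [hφdef, hqm])
    have hfac : (0 : ℝ) < (s + 1).factorial := by positivity
    have hKle : ‖K‖ ≤ M / (s + 1).factorial := by
      rw [le_div_iff₀ hfac]
      simp only [hφdef, hder, Polynomial.eval_C] at hξ0
      have h1 : c * (F (s + 1) ξ - ((s + 1).factorial : ℂ) * K) =
          c * F (s + 1) ξ - (((s + 1).factorial * ‖K‖ : ℝ) : ℂ) := by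
        push_cast
        rw [← hc2]; ring
      rw [h1, Complex.sub_re, Complex.ofReal_re, sub_eq_zero] at hξ0
      calc ‖K‖ * (s + 1).factorial = (c * F (s + 1) ξ).re := by rw [hξ0]; ring
        _ ≤ ‖c * F (s + 1) ξ‖ := Complex.re_le_norm _
        _ = ‖F (s + 1) ξ‖ := by rw [norm_mul, hc1, one_mul]
        _ ≤ M := hM ξ hξ
    have hWn : ‖W.eval (y : ℂ)‖ = ∏ m, |y - p m| := by
      rw [hW, Lagrange.eval_nodal, norm_prod]
      refine Finset.prod_congr rfl fun m _ => ?_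
      rw [hv, ← Complex.ofReal_sub, Complex.norm_real, Real.norm_eq_abs]
    have hE : F 0 y - (interpPoly p (F 0)).eval (y : ℂ) = K * W.eval (y : ℂ) := by
      rw [hK, div_mul_cancel₀ _ hWy]
    rw [hE, norm_mul, hWn]
    exact mul_le_mul_of_nonneg_right hKle (Finset.prod_nonneg fun _ _ => abs_nonneg _)

/-- The nodes lie in the cell, so the cut-off does not change the values there and the second
interpolation sees the same data. -/
theorem bunchInterp_bunchInterp {I : Type*} {s : ℕ} {x : I → Fin (s + 1) → ℝ} {n : I}
    (hn : ∀ m, x n m ∈ voronoi (fun k => x k 0) n) (hinj : Function.Injective (x n)) (g : ℝ → ℂ) :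
    bunchInterp x n (bunchInterp x n g) = bunchInterp x n g := by
  have h : interpPoly (x n) (bunchInterp x n g) = interpPoly (x n) g := by
    unfold interpPoly
    congr 1
    funext m
    rw [bunchInterp, indicator_of_mem (hn m), eval_interpPoly_node hinj]
  rw [bunchInterp, h]; rfl

/-! ### Wirtinger's inequality -/

/-- A Riccati argument: w = k tan(k(b - x)) solves w' = -(k² + w²) with w(b) = 0. Expanding |u' -
wu|² ≥ 0 bounds k²|u|² + (w|u|²)' by |u'|², and the total derivative integrates to 0 because u(a) =
0 = w(b). The strict bound on k keeps w finite at a. -/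
theorem sq_mul_integral_le_of_lt {u u' : ℝ → ℂ} (hu : ∀ x, HasDerivAt u (u' x) x)
    (hu' : Continuous u') {a b k : ℝ} (hab : a ≤ b) (hk : 0 < k) (hkb : k * (b - a) < Real.pi / 2)
    (h0 : u a = 0) :
    k ^ 2 * ∫ x in a..b, ‖u x‖ ^ 2 ≤ ∫ x in a..b, ‖u' x‖ ^ 2 := by
  have huc : Continuous u := continuous_iff_continuousAt.2 fun x => (hu x).continuousAt
  have hcos : ∀ x ∈ Icc a b, Real.cos (k * (b - x)) ≠ 0 := fun x hx => by
    have h1 : 0 ≤ k * (b - x) := mul_nonneg hk.le (by linarith [hx.2])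
    have h2 : k * (b - x) ≤ k * (b - a) := by gcongr; exact hx.1
    exact (Real.cos_pos_of_mem_Ioo ⟨by linarith [Real.pi_pos], by linarith⟩).ne'
  set w : ℝ → ℝ := fun x => k * Real.tan (k * (b - x)) with hw
  have hwd : ∀ x ∈ Icc a b, HasDerivAt w (-(k ^ 2 + w x ^ 2)) x := by
    intro x hx
    have h1 : HasDerivAt (fun x : ℝ => k * (b - x)) (k * (0 - 1)) x :=
      (((hasDerivAt_const x b).sub (hasDerivAt_id x)).const_mul k)
    have h2 := ((Real.hasDerivAt_tan (hcos x hx)).comp x h1).const_mul k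
    refine h2.congr_deriv ?_
    have h3 := Real.tan_eq_sin_div_cos (k * (b - x))
    have h4 := Real.sin_sq_add_cos_sq (k * (b - x))
    have h5 := hcos x hx
    rw [hw]
    simp only [h3]
    field_simp
    linear_combination h4
  have hwc : ContinuousOn w (Icc a b) := fun x hx => (hwd x hx).continuousAt.continuousWithinAt
  set ip : ℝ → ℝ := fun x => inner ℝ (u x) (u' x) with hip
  have hipc : Continuous ip := huc.inner hu'
  have hnd : ∀ x, HasDerivAt (fun x => ‖u x‖ ^ 2) (2 * ip x) x := fun x => (hu x).norm_sq
  have hprod : ∀ x ∈ Icc a b, HasDerivAt (fun x => w x * ‖u x‖ ^ 2)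
      (-(k ^ 2 + w x ^ 2) * ‖u x‖ ^ 2 + w x * (2 * ip x)) x := fun x hx =>
    (hwd x hx).mul (hnd x)
  have hI := Set.uIcc_of_le hab
  have hint : IntervalIntegrable
      (fun x => -(k ^ 2 + w x ^ 2) * ‖u x‖ ^ 2 + w x * (2 * ip x)) volume a b := by
    apply ContinuousOn.intervalIntegrable
    rw [hI]
    fun_prop
  have hftc := intervalIntegral.integral_eq_sub_of_hasDerivAt
    (fun x hx => hprod x (by rwa [hI] at hx)) hint
  have hw0 : w b = 0 := by simp [hw]
  rw [hw0, h0] at hftc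
  simp only [zero_mul, norm_zero, ne_eq, OfNat.ofNat_ne_zero, not_false_eq_true, zero_pow,
    mul_zero, sub_zero] at hftc
  have hi1 : IntervalIntegrable (fun x => ‖u' x‖ ^ 2) volume a b :=
    Continuous.intervalIntegrable (by fun_prop) _ _
  have hi2 : IntervalIntegrable (fun x => k ^ 2 * ‖u x‖ ^ 2) volume a b :=
    Continuous.intervalIntegrable (by fun_prop) _ _
  have key : ∫ x in a..b, (k ^ 2 * ‖u x‖ ^ 2 +
      (-(k ^ 2 + w x ^ 2) * ‖u x‖ ^ 2 + w x * (2 * ip x))) ≤ ∫ x in a..b, ‖u' x‖ ^ 2 := by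
    refine intervalIntegral.integral_mono_on hab (hi2.add hint) hi1 fun x _ => ?_
    have h1 : ip x ≤ ‖u x‖ * ‖u' x‖ := real_inner_le_norm _ _
    have h2 : 0 ≤ ‖u' x - w x • u x‖ ^ 2 := by positivity
    rw [norm_sub_sq_real, norm_smul, inner_smul_right, real_inner_comm, mul_pow,
      Real.norm_eq_abs, sq_abs] at h2
    simp only [hip]
    nlinarith
  rw [intervalIntegral.integral_add hi2 hint, hftc, add_zero,
    intervalIntegral.integral_const_mul] at key
  exact key

/-- The sharp Wirtinger (Poincaré) inequality for functions vanishing at the left end point. -/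
theorem integral_norm_sq_le_left {u u' : ℝ → ℂ} (hu : ∀ x, HasDerivAt u (u' x) x)
    (hu' : Continuous u') {a b : ℝ} (hab : a ≤ b) (h0 : u a = 0) :
    ∫ x in a..b, ‖u x‖ ^ 2 ≤ (2 * (b - a) / Real.pi) ^ 2 * ∫ x in a..b, ‖u' x‖ ^ 2 := by
  rcases hab.eq_or_lt with rfl | hlt
  · simp
  have hpi := Real.pi_pos
  have hL : 0 < b - a := by linarith
  set k₀ : ℝ := Real.pi / (2 * (b - a)) with hk₀
  have hk₀pos : 0 < k₀ := by positivity
  have h1 : Filter.Tendsto (fun k : ℝ => k ^ 2 * ∫ x in a..b, ‖u x‖ ^ 2) (nhdsWithin k₀ (Iio k₀))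
      (nhds (k₀ ^ 2 * ∫ x in a..b, ‖u x‖ ^ 2)) :=
    ((continuous_id.pow 2).mul continuous_const).continuousAt.continuousWithinAt
  have h2 : k₀ ^ 2 * ∫ x in a..b, ‖u x‖ ^ 2 ≤ ∫ x in a..b, ‖u' x‖ ^ 2 := by
    -- At k₀ itself the tangent has a pole at a, so the sharp constant is reached by letting k
    -- increase to k₀.
    refine le_of_tendsto h1 ?_
    filter_upwards [Ioo_mem_nhdsLT hk₀pos] with k hk
    refine sq_mul_integral_le_of_lt hu hu' hab hk.1 ?_ h0
    calc k * (b - a) < k₀ * (b - a) := by gcongr; exact hk.2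
      _ = Real.pi / 2 := by rw [hk₀]; field_simp
  have h3 : 2 * (b - a) / Real.pi = k₀⁻¹ := by rw [hk₀]; field_simp
  rw [h3, inv_pow]
  rwa [← div_eq_inv_mul, le_div_iff₀' (by positivity)]

theorem integral_norm_sq_le_right {u u' : ℝ → ℂ} (hu : ∀ x, HasDerivAt u (u' x) x)
    (hu' : Continuous u') {a b : ℝ} (hab : a ≤ b) (h0 : u b = 0) :
    ∫ x in a..b, ‖u x‖ ^ 2 ≤ (2 * (b - a) / Real.pi) ^ 2 * ∫ x in a..b, ‖u' x‖ ^ 2 := by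
  have h := integral_norm_sq_le_left (u := fun x => u (-x)) (u' := fun x => -u' (-x))
    (a := -b) (b := -a) (fun x => by
      simpa using! (hu (-x)).scomp x (hasDerivAt_neg x)) (by fun_prop) (by linarith) (by simpa)
  simp only [norm_neg] at h
  rw [intervalIntegral.integral_comp_neg (fun x => ‖u x‖ ^ 2),
    intervalIntegral.integral_comp_neg (fun x => ‖u' x‖ ^ 2)] at h
  simpa [neg_add_eq_sub] using h

/-- Wirtinger's inequality for functions vanishing at some point of the interval. -/
theorem integral_norm_sq_le_of_mem {u u' : ℝ → ℂ} (hu : ∀ x, HasDerivAt u (u' x) x)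
    (hu' : Continuous u') {a b c : ℝ} (hc : c ∈ Icc a b) (h0 : u c = 0) :
    ∫ x in a..b, ‖u x‖ ^ 2 ≤ (2 * (b - a) / Real.pi) ^ 2 * ∫ x in a..b, ‖u' x‖ ^ 2 := by
  have huc : Continuous u := continuous_iff_continuousAt.2 fun x => (hu x).continuousAt
  have hpi := Real.pi_pos
  have hi : ∀ {v : ℝ → ℂ}, Continuous v → ∀ p q : ℝ,
      IntervalIntegrable (fun x => ‖v x‖ ^ 2) volume p q := fun hv p q =>
    Continuous.intervalIntegrable (by fun_prop) _ _
  rw [← intervalIntegral.integral_add_adjacent_intervals (hi huc a c) (hi huc c b),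
    ← intervalIntegral.integral_add_adjacent_intervals (hi hu' a c) (hi hu' c b), mul_add]
  have hn : ∀ {p q : ℝ}, p ≤ q → 0 ≤ ∫ x in p..q, ‖u' x‖ ^ 2 := fun h =>
    intervalIntegral.integral_nonneg h fun x _ => by positivity
  have hca : 0 ≤ c - a := by linarith [hc.1]
  have hbc : 0 ≤ b - c := by linarith [hc.2]
  -- Both sides of c use the sharp one-sided inequality; each length is then enlarged to b - a,
  -- since c may be an end point.
  refine add_le_add ((integral_norm_sq_le_right hu hu' hc.1 h0).trans ?_)
    ((integral_norm_sq_le_left hu hu' hc.2 h0).trans ?_)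
  · refine mul_le_mul_of_nonneg_right ?_ (hn hc.1)
    gcongr
    exact hc.2
  · refine mul_le_mul_of_nonneg_right ?_ (hn hc.2)
    gcongr
    exact hc.1

/-! ### L² norms on an interval and the error in one bunch -/

theorem lpNorm_two_sq {α : Type*} [MeasurableSpace α] {μ : Measure α} {f : α → ℂ}
    (hf : AEStronglyMeasurable f μ) : lpNorm f 2 μ ^ 2 = ∫ x, ‖f x‖ ^ 2 ∂μ := by
  rw [lpNorm_eq_integral_norm_rpow_toReal (by norm_num) (by norm_num) hf,
    ← Real.rpow_natCast, ← Real.rpow_mul (by positivity)]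
  simp

theorem memLp_restrict_Icc {f : ℝ → ℂ} (hf : Continuous f) (a b : ℝ) :
    MemLp f 2 (volume.restrict (Icc a b)) := by
  obtain ⟨C, hC⟩ := isCompact_Icc.exists_bound_of_continuousOn (s := Icc a b) hf.continuousOn
  exact MemLp.of_bound hf.aestronglyMeasurable C
    ((ae_restrict_iff' measurableSet_Icc).2 (Filter.Eventually.of_forall hC))

theorem lpNorm_restrict_Icc_sq {f : ℝ → ℂ} (hf : Continuous f) {a b : ℝ} (hab : a ≤ b) :
    lpNorm f 2 (volume.restrict (Icc a b)) ^ 2 = ∫ x in a..b, ‖f x‖ ^ 2 := by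
  rw [lpNorm_two_sq hf.aestronglyMeasurable, integral_Icc_eq_integral_Ioc,
    intervalIntegral.integral_of_le hab]

theorem lpNorm_restrict_Icc_mono {f g : ℝ → ℂ} (hf : Continuous f) (hg : Continuous g) {a b : ℝ}
    (hab : a ≤ b) (h : ∀ x ∈ Icc a b, ‖f x‖ ≤ ‖g x‖) :
    lpNorm f 2 (volume.restrict (Icc a b)) ≤ lpNorm g 2 (volume.restrict (Icc a b)) := by
  rw [← sq_le_sq₀ lpNorm_nonneg lpNorm_nonneg, lpNorm_restrict_Icc_sq hf hab,
    lpNorm_restrict_Icc_sq hg hab]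
  refine intervalIntegral.integral_mono_on hab (Continuous.intervalIntegrable (by fun_prop) _ _)
    (Continuous.intervalIntegrable (by fun_prop) _ _) fun x hx => ?_
  have := h x hx
  gcongr

/-- The `L²` error of the interpolation in one bunch. -/
theorem lpNorm_sub_interpPoly_le {s : ℕ} {p : Fin (s + 1) → ℝ} (hp : Function.Injective p)
    {F : ℕ → ℝ → ℂ} (hF : ∀ k x, HasDerivAt (F k) (F (k + 1) x) x) {a b δ τ : ℝ} (hδ : 0 ≤ δ)
    (hτ : 0 ≤ τ) (hba : b - a ≤ 2 * δ) (hpm : ∀ m, p m ∈ Icc a b)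
    (hy : ∀ y ∈ Icc a b, |y - p 0| ≤ δ) (hpτ : ∀ m, |p m - p 0| ≤ τ * δ) :
    lpNorm (fun y => F 0 y - (interpPoly p (F 0)).eval (y : ℂ)) 2 (volume.restrict (Icc a b)) ≤
      (1 + τ) ^ s * δ ^ (s + 1) / (s + 1).factorial *
        lpNorm (F (s + 1)) 2 (volume.restrict (Icc a b)) +
      (1 + τ) ^ s * δ ^ (s + 1) / (s + 1).factorial * (4 * δ / Real.pi) *
        lpNorm (F (s + 2)) 2 (volume.restrict (Icc a b)) := by
  have hpi := Real.pi_pos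
  have hFc : ∀ k, Continuous (F k) := fun k =>
    continuous_iff_continuousAt.2 fun x => (hF k x).continuousAt
  have hab : a ≤ b := (hpm 0).1.trans (hpm 0).2
  set C : ℝ := (1 + τ) ^ s * δ ^ (s + 1) / (s + 1).factorial with hC
  have hC0 : 0 ≤ C := by positivity
  set μ := volume.restrict (Icc a b) with hμ
  obtain ⟨ξ, hξ, hmax⟩ := isCompact_Icc.exists_isMaxOn (nonempty_Icc.2 hab)
    (hFc (s + 1)).norm.continuousOn
  have hbd : ∀ y ∈ Icc a b, ‖F 0 y - (interpPoly p (F 0)).eval (y : ℂ)‖ ≤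
      C * ‖F (s + 1) ξ‖ := by
    intro y hyI
    refine (norm_sub_interpPoly_le hp hF hpm hyI fun t ht => hmax ht).trans ?_
    -- The centre is within δ of y; each of the other s nodes is within τδ of the centre, hence
    -- within (1 + τ)δ of y.
    have h1 : ∏ m, |y - p m| ≤ δ * ((1 + τ) * δ) ^ s := by
      rw [Fin.prod_univ_succ]
      refine mul_le_mul (hy y hyI) ?_ (Finset.prod_nonneg fun _ _ => abs_nonneg _) hδ
      have h2 : ∀ m : Fin s, |y - p m.succ| ≤ (1 + τ) * δ := by
        intro m
        have e1 : y - p m.succ = (y - p 0) - (p m.succ - p 0) := by ring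
        rw [e1]
        refine (abs_sub _ _).trans ?_
        linarith [hy y hyI, hpτ m.succ]
      refine (Finset.prod_le_prod (fun _ _ => abs_nonneg _) fun m _ => h2 m).trans_eq ?_
      simp
    refine (mul_le_mul_of_nonneg_left h1 (by positivity)).trans_eq ?_
    rw [hC, mul_pow]
    ring
  have hconst : lpNorm (fun _ : ℝ => F (s + 1) ξ) 2 μ ≤
      lpNorm (F (s + 1)) 2 μ + 4 * δ / Real.pi * lpNorm (F (s + 2)) 2 μ := by
    have hd : Continuous fun y => F (s + 1) y - F (s + 1) ξ := (hFc _).sub continuous_const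
    have h1 := lpNorm_sub_le (memLp_restrict_Icc (hFc (s + 1)) a b)
      (g := fun y => F (s + 1) y - F (s + 1) ξ) (p := 2) (by norm_num)
    have e1 : (F (s + 1) - fun y => F (s + 1) y - F (s + 1) ξ) = fun _ => F (s + 1) ξ := by
      funext y; simp
    rw [e1] at h1
    refine h1.trans (add_le_add_right ?_ _)
    rw [← sq_le_sq₀ lpNorm_nonneg (mul_nonneg (by positivity) lpNorm_nonneg), mul_pow, lpNorm_restrict_Icc_sq hd hab,
      lpNorm_restrict_Icc_sq (hFc _) hab]
    refine (integral_norm_sq_le_of_mem (fun x => (hF (s + 1) x).sub_const _) (hFc (s + 2)) hξ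
      (sub_self _)).trans (mul_le_mul_of_nonneg_right ?_
        (intervalIntegral.integral_nonneg hab fun x _ => by positivity))
    have h0 : 0 ≤ b - a := by linarith
    have h2 : 2 * (b - a) ≤ 4 * δ := by linarith
    gcongr
  have hpoly : Continuous fun y : ℝ => (interpPoly p (F 0)).eval (y : ℂ) :=
    (interpPoly p (F 0)).continuous.comp Complex.continuous_ofReal
  have h1 : lpNorm (fun y => F 0 y - (interpPoly p (F 0)).eval (y : ℂ)) 2 μ ≤
      lpNorm (fun _ : ℝ => (C : ℂ) * F (s + 1) ξ) 2 μ := by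
    refine lpNorm_restrict_Icc_mono ((hFc 0).sub hpoly) continuous_const hab fun y hyI => ?_
    rw [norm_mul, Complex.norm_real, Real.norm_of_nonneg hC0]
    exact hbd y hyI
  have h2 : lpNorm (fun _ : ℝ => (C : ℂ) * F (s + 1) ξ) 2 μ =
      C * lpNorm (fun _ : ℝ => F (s + 1) ξ) 2 μ := by
    simp [abs_of_nonneg hC0, mul_assoc]
  rw [h2] at h1
  refine h1.trans ((mul_le_mul_of_nonneg_left hconst hC0).trans_eq ?_)
  ring

/-! ### Minkowski's inequality in ℓ², and extension to a projection -/

theorem sqrt_tsum_sq_sub_le {I : Type*} {a b u w : I → ℝ} {C D : ℝ} (hC : 0 ≤ C) (hD : 0 ≤ D)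
    (ha : Summable fun n => a n ^ 2) (hu : Summable fun n => u n ^ 2)
    (hw : Summable fun n => w n ^ 2) (h : ∀ n, |b n - a n| ≤ C * u n + D * w n) :
    (Summable fun n => b n ^ 2) ∧
      |√(∑' n, b n ^ 2) - √(∑' n, a n ^ 2)| ≤
        C * √(∑' n, u n ^ 2) + D * √(∑' n, w n ^ 2) := by
  have hmem : ∀ {v : I → ℝ}, (Summable fun n => v n ^ 2) → Memℓp v 2 := fun {v} hv =>
    memℓp_gen (by simpa using hv)
  have hnorm : ∀ v : lp (fun _ : I => ℝ) 2, ‖v‖ = √(∑' n, v n ^ 2) := fun v => by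
    rw [lp.norm_eq_tsum_rpow (by norm_num), Real.sqrt_eq_rpow]
    simp
  set A : lp (fun _ : I => ℝ) 2 := ⟨a, hmem ha⟩
  set U : lp (fun _ : I => ℝ) 2 := ⟨u, hmem hu⟩
  set V : lp (fun _ : I => ℝ) 2 := ⟨w, hmem hw⟩
  set E : lp (fun _ : I => ℝ) 2 := C • U + D • V
  have hE : ∀ n, E n = C * u n + D * w n := fun n => rfl
  have hEs : Summable fun n => E n ^ 2 := by
    have := (lp.memℓp E).summable (by norm_num)
    simpa using this
  have hds : Summable fun n => (b n - a n) ^ 2 :=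
    Summable.of_nonneg_of_le (fun n => sq_nonneg _) (fun n => by
      rw [← sq_abs]
      have := h n
      rw [← hE] at this
      gcongr) hEs
  -- Square summability of b is not given; it comes from writing b as (b - a) + a.
  set B : lp (fun _ : I => ℝ) 2 := ⟨fun n => b n - a n, hmem hds⟩ + A
  have hB : ∀ n, B n = b n := fun n => sub_add_cancel _ _
  refine ⟨?_, ?_⟩
  · have := (lp.memℓp B).summable (by norm_num)
    simpa [hB] using this
  · have h1 : ‖B - A‖ ≤ ‖E‖ := by
      have e1 : B - A = ⟨fun n => b n - a n, hmem hds⟩ := add_sub_cancel_right _ _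
      rw [e1, hnorm, hnorm]
      refine Real.sqrt_le_sqrt (Summable.tsum_le_tsum (fun n => ?_) hds hEs)
      change (b n - a n) ^ 2 ≤ _
      rw [← sq_abs]
      have := h n
      rw [← hE] at this
      gcongr
    have h2 : ‖E‖ ≤ C * ‖U‖ + D * ‖V‖ := by
      refine (norm_add_le _ _).trans ?_
      rw [norm_smul, norm_smul, Real.norm_of_nonneg hC, Real.norm_of_nonneg hD]
    have h3 := (abs_norm_sub_norm_le B A).trans (h1.trans h2)
    simpa only [hnorm, hB] using h3

/-- A bounded operator defined on a closed subspace, with values in a finite dimensional subspace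
that meets it trivially, extends to a projection. -/
theorem exists_projection_extending {K : Type*} [NormedAddCommGroup K] [InnerProductSpace ℂ K]
    [CompleteSpace K] {H : Submodule ℂ K} (hH : IsClosed (H : Set K)) (W : Submodule ℂ K)
    [FiniteDimensional ℂ W] (hHW : ∀ g ∈ H, g ∈ W → g = 0) (P : H →L[ℂ] K)
    (hP : ∀ f, P f ∈ W) :
    ∃ Q : K →L[ℂ] K, (∀ g, Q (Q g) = Q g) ∧ IsClosed (range Q) ∧ ∀ f : H, Q f = P f := by
  have : CompleteSpace H := hH.completeSpace_coe
  set pr : K →L[ℂ] H := H.orthogonalProjectionOnto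
  have hpr : ∀ f : H, pr f = f := fun f => H.orthogonalProjectionOnto_mem_subspace_eq_self f
  set T : K →L[ℂ] K := ContinuousLinearMap.id ℂ K - H.subtypeL.comp pr
  have hT : ∀ v, T v = v - pr v := fun v => rfl
  have hTH : ∀ f : H, T f = 0 := fun f => by rw [hT, hpr, sub_self]
  set Tw : W →ₗ[ℂ] K := T.toLinearMap.comp W.subtype
  have hTw : ∀ w : W, Tw w = T w := fun w => rfl
  have hinj : Function.Injective Tw := by
    rw [← LinearMap.ker_eq_bot, LinearMap.ker_eq_bot']
    intro w hw
    rw [hTw, hT, sub_eq_zero] at hw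
    exact Subtype.ext (hHW w (hw ▸ (pr w).2) w.2)
  set e := LinearEquiv.ofInjective Tw hinj
  obtain ⟨S, hS⟩ := ContinuousLinearMap.exist_extension_of_finiteDimensional_range
    (LinearMap.toContinuousLinearMap e.symm.toLinearMap)
  have hSw : ∀ w : W, S (T w) = w := fun w => by
    have h1 := DFunLike.congr_fun hS (e w)
    simpa [hTw, e] using h1.symm
  -- T projects onto the orthogonal complement of H and is injective on W, with S recovering w from
  -- T w. Thus Q is P on H, where T vanishes, and the identity on W; as it takes values in W, it is
  -- idempotent.
  set Q : K →L[ℂ] K := P.comp pr +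
    (ContinuousLinearMap.id ℂ K - P.comp pr).comp (W.subtypeL.comp (S.comp T))
  have hQ : ∀ v, Q v = P (pr v) + ((S (T v) : K) - P (pr (S (T v) : K))) := fun v => rfl
  have hQW : ∀ v, Q v ∈ W := fun v => by
    rw [hQ]
    exact W.add_mem (hP _) (W.sub_mem (S (T v)).2 (hP _))
  have hQw : ∀ w ∈ W, Q w = w := fun w hw => by
    rw [hQ, hSw ⟨w, hw⟩]
    simp
  have hidem : ∀ g, Q (Q g) = Q g := fun g => hQw _ (hQW g)
  refine ⟨Q, hidem, ?_, fun f => ?_⟩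
  · have : range Q = {g | Q g = g} := by
      ext g
      exact ⟨by rintro ⟨v, rfl⟩; exact hidem v, fun h => ⟨g, h⟩⟩
    rw [this]
    exact isClosed_eq Q.continuous continuous_id
  · rw [hQ, hTH, hpr]
    simp

/-! ### Geometry of Voronoi cells on the line -/

section Voronoi

variable {I : Type*}

theorem isClosed_voronoi (c : I → ℝ) (n : I) : IsClosed (voronoi c n) := by
  have : voronoi c n = ⋂ m, {y | |y - c n| ≤ |y - c m|} := by
    ext y; simp [voronoi]
  rw [this]
  exact isClosed_iInter fun m => isClosed_le (by fun_prop) (by fun_prop)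

/-- After squaring, the y² terms cancel and each condition is affine in y, so the cell is an
intersection of half-lines. -/
theorem ordConnected_voronoi (c : I → ℝ) (n : I) : (voronoi c n).OrdConnected := by
  refine ⟨fun y hy z hz t ht m => ?_⟩
  have h1 := sq_le_sq.2 (hy m)
  have h2 := sq_le_sq.2 (hz m)
  refine sq_le_sq.1 ?_
  rcases le_total (c n) (c m) with h | h
  · nlinarith [mul_nonneg (sub_nonneg.2 h) (sub_nonneg.2 ht.2)]
  · nlinarith [mul_nonneg (sub_nonneg.2 h) (sub_nonneg.2 ht.1)]

theorem centre_mem_voronoi (c : I → ℝ) (n : I) : c n ∈ voronoi c n := fun m => by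
  simp

/-- Two cells with distinct centres can share only the midpoint of their centres. -/
theorem aedisjoint_voronoi {c : I → ℝ} (hc : Function.Injective c) :
    Pairwise (Function.onFun (AEDisjoint volume) (voronoi c)) := by
  intro n m hnm
  refine measure_mono_null (t := {(c n + c m) / 2}) (fun y hy => ?_) (by simp)
  have h : |y - c n| = |y - c m| := le_antisymm (hy.1 m) (hy.2 n)
  rcases abs_eq_abs.1 h with h | h
  · exact absurd (hc (by linarith)) hnm
  · rw [mem_singleton_iff]; linarith

end Voronoi

namespace IsBunchedSamplingSet

variable {I : Type*} {s : ℕ} {x : I → Fin (s + 1) → ℝ} {r : I → ℝ} {δ τ : ℝ}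

theorem iUnion_voronoi (hx : IsBunchedSamplingSet x r δ τ) :
    ⋃ n, voronoi (fun k => x k 0) n = univ :=
  eq_univ_of_forall fun y => mem_iUnion.2 (hx.exists_nearest y)

theorem abs_sub_centre_le (hx : IsBunchedSamplingSet x r δ τ) {n : I} {y : ℝ}
    (hy : y ∈ voronoi (fun k => x k 0) n) : |y - x n 0| ≤ δ := by
  have : Nonempty I := ⟨n⟩
  exact (le_ciInf hy).trans (hx.density.1 (mem_range_self y))

theorem density_nonneg (hx : IsBunchedSamplingSet x r δ τ) : 0 ≤ δ := by
  obtain ⟨n, hn⟩ := hx.exists_nearest 0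
  exact (abs_nonneg _).trans (hx.abs_sub_centre_le hn)

/-- A cell is closed, order connected and within δ of its centre, hence a compact interval of length
at most 2δ. -/
theorem exists_voronoi_eq_Icc (hx : IsBunchedSamplingSet x r δ τ) (n : I) :
    ∃ a b, b - a ≤ 2 * δ ∧ voronoi (fun k => x k 0) n = Icc a b := by
  set V := voronoi (fun k => x k 0) n with hV
  have hcomp : IsCompact V := by
    refine (isCompact_closedBall (x n 0) δ).of_isClosed_subset (isClosed_voronoi _ n) ?_
    intro y hy
    rw [Metric.mem_closedBall, Real.dist_eq]
    exact hx.abs_sub_centre_le hy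
  have hne : V.Nonempty := ⟨_, centre_mem_voronoi (fun k => x k 0) n⟩
  have h := eq_Icc_of_connected_compact
    ⟨hne, (ordConnected_voronoi (fun k => x k 0) n).isPreconnected⟩ hcomp
  refine ⟨sInf V, sSup V, ?_, h⟩
  have h1 := hx.abs_sub_centre_le (hcomp.sInf_mem hne)
  have h2 := hx.abs_sub_centre_le (hcomp.sSup_mem hne)
  rw [abs_le] at h1 h2
  linarith [h1.1, h2.2]

theorem node_mem_voronoi (hx : IsBunchedSamplingSet x r δ τ) (n : I) (m : Fin (s + 1)) :
    x n m ∈ voronoi (fun k => x k 0) n :=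
  hx.subset_voronoi n (hx.node_mem n m)

theorem abs_node_sub_centre_le (hx : IsBunchedSamplingSet x r δ τ) (n : I) (m : Fin (s + 1)) :
    |x n m - x n 0| ≤ τ * δ := by
  refine le_trans ?_ (hx.width.1 (mem_range_self n))
  have := hx.node_mem n m
  rw [abs_le]
  constructor <;> linarith [this.1, this.2]

end IsBunchedSamplingSet

/-! ### The interpolation operators on B(Ω) -/

/-- Evaluation at a point, as a bounded functional on `B(Ω)`. -/
theorem exists_evaluation {Ω : Set ℝ} (hΩ : IsCompact Ω) (y : ℝ) :
    ∃ L : bandlimited Ω →L[ℂ] ℂ, ∀ f, L f = pointValue f y := by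
  obtain ⟨C, -, hC⟩ := exists_norm_pointValue_le hΩ
  exact ⟨LinearMap.mkContinuous
    { toFun := fun f : bandlimited Ω => pointValue f y
      map_add' := fun f g => pointValue_add hΩ f.2 g.2 y
      map_smul' := fun c f => pointValue_smul hΩ f.2 c y } C fun f => hC f f.2 y, fun f => rfl⟩

/-- A bandlimited function that vanishes almost everywhere outside a bounded interval is zero. -/
theorem eq_zero_of_ae_eq_zero_outside {Ω : Set ℝ} (hΩ : IsCompact Ω) {f : L2}
    (hf : f ∈ bandlimited Ω) {a b : ℝ} (h0 : ∀ᵐ y, y ∉ Icc a b → f y = 0) : f = 0 := by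
  have hU : IsOpen (Icc a b)ᶜ := isClosed_Icc.isOpen_compl
  refine eq_zero_of_pointValue_eq_zero hΩ hf hU ⟨b + 1, fun h => by linarith [h.2]⟩ ?_
  refine Measure.eqOn_open_of_ae_eq (μ := volume) (g := fun _ => 0) ?_ hU
    (continuous_pointValue hΩ hf).continuousOn continuousOn_const
  rw [Filter.EventuallyEq, ae_restrict_iff' hU.measurableSet]
  filter_upwards [pointValue_ae_eq hΩ hf, h0] with y h1 h2 h3
  rw [h1, h2 h3]

/-- The operators `P n`, together with their extensions to projections of `L²(ℝ)`. -/
theorem exists_bunchInterp_operator {I : Type*} {s : ℕ} {x : I → Fin (s + 1) → ℝ} {n : I}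
    {Ω : Set ℝ} (hΩ : IsCompact Ω) {a b : ℝ} (hV : voronoi (fun k => x k 0) n = Icc a b) :
    ∃ P : bandlimited Ω →L[ℂ] L2,
      (∀ f : bandlimited Ω, P f =ᵐ[volume] bunchInterp x n (pointValue f)) ∧
      ∃ Q : L2 →L[ℂ] L2, (∀ g, Q (Q g) = Q g) ∧ IsClosed (range Q) ∧
        ∀ f : bandlimited Ω, Q f = P f := by
  choose L hL using exists_evaluation hΩ
  set B : Fin (s + 1) → ℝ → ℂ := fun m y =>
    (Lagrange.basis Finset.univ (fun k => ((x n k : ℝ) : ℂ)) m).eval (y : ℂ) with hB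
  have hBc : ∀ m, Continuous (B m) := fun m =>
    (Lagrange.basis Finset.univ (fun k => ((x n k : ℝ) : ℂ)) m).continuous.comp
      Complex.continuous_ofReal
  have hBm : ∀ m, MemLp ((Icc a b).indicator (B m)) 2 volume := fun m =>
    (memLp_indicator_iff_restrict measurableSet_Icc).2 (memLp_restrict_Icc (hBc m) a b)
  set e : Fin (s + 1) → L2 := fun m => (hBm m).toLp _ with he
  have hea : ∀ m, (e m : ℝ → ℂ) =ᵐ[volume] (Icc a b).indicator (B m) := fun m =>
    (hBm m).coeFn_toLp
  -- Lagrange's formula: finitely many bounded point evaluations times the basis polynomials cut off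
  -- to the cell. This makes P bounded and puts its range in the span of the e m.
  set P : bandlimited Ω →L[ℂ] L2 := ∑ m, (L (x n m)).smulRight (e m) with hP
  have hPf : ∀ f, P f = ∑ m, pointValue f (x n m) • e m := fun f => by
    simp [hP, hL]
  set W : Submodule ℂ L2 := Submodule.span ℂ (range e) with hW
  have : FiniteDimensional ℂ W := FiniteDimensional.span_of_finite ℂ (finite_range e)
  have hPW : ∀ f, P f ∈ W := fun f => by
    rw [hPf]
    exact Submodule.sum_mem _ fun m _ =>
      Submodule.smul_mem _ _ (Submodule.subset_span (mem_range_self m))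
  have hW0 : ∀ g ∈ W, ∀ᵐ y, y ∉ Icc a b → (g : ℝ → ℂ) y = 0 := by
    intro g hg
    induction hg using Submodule.span_induction with
    | mem g hg =>
      obtain ⟨m, rfl⟩ := hg
      filter_upwards [hea m] with y hy h
      rw [hy, indicator_of_notMem h]
    | zero =>
      filter_upwards [Lp.coeFn_zero ℂ 2 (volume : Measure ℝ)] with y hy _
      rw [hy, Pi.zero_apply]
    | add g h _ _ ihg ihh =>
      filter_upwards [ihg, ihh, Lp.coeFn_add g h] with y h1 h2 h3 h4
      rw [h3, Pi.add_apply, h1 h4, h2 h4, add_zero]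
    | smul c g _ ih =>
      filter_upwards [ih, Lp.coeFn_smul c g] with y h1 h2 h3
      rw [h2, Pi.smul_apply, h1 h3, smul_zero]
  refine ⟨P, fun f => ?_, exists_projection_extending (isClosed_bandlimited hΩ) W
    (fun g hg hgW => eq_zero_of_ae_eq_zero_outside hΩ hg (hW0 g hgW)) P hPW⟩
  rw [hPf]
  have h1 : (⇑(∑ m, pointValue f (x n m) • e m) : ℝ → ℂ) =ᵐ[volume]
      ∑ m, ⇑(pointValue f (x n m) • e m) := Lp.coeFn_finsetSum _ _
  have h2 : ∀ᵐ y, ∀ m, (⇑(pointValue f (x n m) • e m) : ℝ → ℂ) y =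
      pointValue f (x n m) * (Icc a b).indicator (B m) y := by
    rw [ae_all_iff]
    intro m
    filter_upwards [Lp.coeFn_smul (pointValue f (x n m)) (e m), hea m] with y h3 h4
    rw [h3, Pi.smul_apply, h4, smul_eq_mul]
  filter_upwards [h1, h2] with y h3 h4
  rw [h3, Finset.sum_apply, bunchInterp, hV]
  simp only [h4]
  by_cases hy : y ∈ Icc a b
  · simp only [indicator_of_mem hy]
    rw [interpPoly, Lagrange.interpolate_apply, Polynomial.eval_finsetSum]
    simp [hB]
  · simp only [indicator_of_notMem hy, mul_zero, Finset.sum_const_zero]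

/-! ### Summation over the cells -/

theorem hasSum_lpNorm_sq {I : Type*} [Countable I] {V : I → Set ℝ}
    (hm : ∀ n, MeasurableSet (V n))
    (hd : Pairwise (Function.onFun (AEDisjoint volume) V)) (hU : ⋃ n, V n = univ) {f : L2}
    {F : ℝ → ℂ} (hF : F =ᵐ[volume] f) :
    HasSum (fun n => lpNorm F 2 (volume.restrict (V n)) ^ 2) (‖f‖ ^ 2) := by
  have hFm : AEStronglyMeasurable F volume := (Lp.memLp f).1.congr hF.symm
  have hF2 : MemLp F 2 volume := (memLp_congr_ae hF).2 (Lp.memLp f)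
  have h1 : Integrable (fun y => ‖F y‖ ^ 2) volume := hF2.integrable_norm_pow (by norm_num)
  have h2 := hasSum_integral_iUnion_ae (fun n => (hm n).nullMeasurableSet) hd
    (f := fun y => ‖F y‖ ^ 2) (μ := volume) h1.integrableOn
  rw [hU, setIntegral_univ, ← lpNorm_two_sq hFm] at h2
  have h3 : lpNorm F 2 volume = ‖f‖ := by
    rw [← toReal_eLpNorm hFm, eLpNorm_congr_ae hF, Lp.norm_def]
  rw [h3] at h2
  convert! h2 using 2 with n
  exact lpNorm_two_sq hFm.restrict

theorem norm_eq_lpNorm_restrict {f : L2} {g : ℝ → ℂ} (hg : Continuous g) {a b : ℝ}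
    (h : f =ᵐ[volume] (Icc a b).indicator g) :
    ‖f‖ = lpNorm g 2 (volume.restrict (Icc a b)) := by
  rw [Lp.norm_def, eLpNorm_congr_ae h, eLpNorm_indicator_eq_eLpNorm_restrict measurableSet_Icc,
    toReal_eLpNorm hg.aestronglyMeasurable]

/-- `hTilde` is strictly increasing on [0, ∞) and equals 1 at `HTilde s τ 1`. The end point z = 0
lies outside the domain of the bijection but is needed when δ m_Ω = 0. -/
theorem hTilde_lt_one {s : ℕ} {τ z : ℝ} (hτ : 0 < τ) (hz : 0 ≤ z) (h : z < HTilde s τ 1) :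
    hTilde s τ z < 1 := by
  have hpi := Real.pi_pos
  have h1 : hTilde s τ (HTilde s τ 1) = 1 :=
    Function.invFunOn_eq ((bijOn_hTilde s hτ).surjOn (mem_Ioi.2 one_pos))
  have h2 : hTilde s τ z < hTilde s τ (HTilde s τ 1) := by
    have h3 : 0 < HTilde s τ 1 := hz.trans_lt h
    unfold hTilde
    refine mul_lt_mul ?_ ?_ (by positivity) (by positivity)
    · gcongr
    · gcongr
  rwa [h1] at h2

/-- The two-sided bound for one function, before passing to operators. -/
theorem sqrt_tsum_lpNorm_sub_le {I : Type*} [Countable I] {Ω : Set ℝ} (hΩ : IsCompact Ω) {s : ℕ}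
    {x : I → Fin (s + 1) → ℝ} {r : I → ℝ} {δ τ : ℝ} (hτ : 0 ≤ τ)
    (hx : IsBunchedSamplingSet x r δ τ) {f : L2} (hf : f ∈ bandlimited Ω) {β : I → ℝ}
    (hβ : ∀ n, β n = lpNorm (fun y : ℝ => (interpPoly (x n) (pointValue f)).eval (y : ℂ)) 2
      (volume.restrict (voronoi (fun k => x k 0) n))) :
    (Summable fun n => β n ^ 2) ∧
      |√(∑' n, β n ^ 2) - ‖f‖| ≤ hTilde s τ (δ * bandwidth Ω) * ‖f‖ := by
  have hpi := Real.pi_pos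
  have hδ := hx.density_nonneg
  have hm0 := bandwidth_nonneg Ω
  obtain ⟨F, hF0, hFm, hFd, hFn⟩ := exists_derivatives hΩ hf
  set V := voronoi (fun k => x k 0) with hVdef
  have hs : ∀ k, HasSum (fun n => lpNorm (pointValue (F k)) 2 (volume.restrict (V n)) ^ 2)
      (‖F k‖ ^ 2) := fun k =>
    hasSum_lpNorm_sq (fun n => (isClosed_voronoi _ n).measurableSet)
      (aedisjoint_voronoi hx.centre_injective) hx.iUnion_voronoi (pointValue_ae_eq hΩ (hFm k))
  have hsq : ∀ k, √(∑' n, lpNorm (pointValue (F k)) 2 (volume.restrict (V n)) ^ 2) = ‖F k‖ :=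
    fun k => by rw [(hs k).tsum_eq, Real.sqrt_sq (norm_nonneg _)]
  set C : ℝ := (1 + τ) ^ s * δ ^ (s + 1) / (s + 1).factorial with hC
  have hC0 : 0 ≤ C := by positivity
  have hD0 : 0 ≤ C * (4 * δ / Real.pi) := by positivity
  have hloc : ∀ n, |β n - lpNorm (pointValue (F 0)) 2 (volume.restrict (V n))| ≤
      C * lpNorm (pointValue (F (s + 1))) 2 (volume.restrict (V n)) +
      C * (4 * δ / Real.pi) * lpNorm (pointValue (F (s + 2))) 2 (volume.restrict (V n)) := by
    intro n
    obtain ⟨a, b, hba, hab⟩ := hx.exists_voronoi_eq_Icc n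
    have h1 := lpNorm_sub_interpPoly_le (hx.node_injective n) hFd hδ hτ hba
      (fun m => hab ▸ hx.node_mem_voronoi n m)
      (fun y hy => hx.abs_sub_centre_le (n := n) (hab ▸ hy)) (hx.abs_node_sub_centre_le n)
    rw [hβ, hVdef, hab, ← hF0]
    refine le_trans ?_ h1
    set p : ℝ → ℂ := fun y : ℝ => (interpPoly (x n) (pointValue (F 0))).eval (y : ℂ)
    have hp : MemLp p 2 (volume.restrict (Icc a b)) :=
      memLp_restrict_Icc ((interpPoly (x n) (pointValue (F 0))).continuous.comp
        Complex.continuous_ofReal) a b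
    have hg : MemLp (pointValue (F 0)) 2 (volume.restrict (Icc a b)) :=
      memLp_restrict_Icc (continuous_pointValue hΩ (hFm 0)) a b
    have h2 := lpNorm_le_lpNorm_add_lpNorm_sub (f := p) hg (by norm_num)
    have h3 := lpNorm_le_lpNorm_add_lpNorm_sub' (f := pointValue (F 0)) hp (by norm_num)
    rw [abs_le]
    constructor
    · change -lpNorm (pointValue (F 0) - p) _ _ ≤ _
      linarith
    · change _ ≤ lpNorm (pointValue (F 0) - p) _ _
      linarith
  obtain ⟨h1, h2⟩ := sqrt_tsum_sq_sub_le hC0 hD0 (hs 0).summable (hs (s + 1)).summable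
    (hs (s + 2)).summable hloc
  refine ⟨h1, ?_⟩
  rw [hsq, hsq, hsq, hF0] at h2
  refine h2.trans ?_
  have h3 : C * ‖F (s + 1)‖ + C * (4 * δ / Real.pi) * ‖F (s + 2)‖ ≤
      C * (bandwidth Ω ^ (s + 1) * ‖f‖) +
        C * (4 * δ / Real.pi) * (bandwidth Ω ^ (s + 2) * ‖f‖) :=
    add_le_add (mul_le_mul_of_nonneg_left (hFn _) hC0) (mul_le_mul_of_nonneg_left (hFn _) hD0)
  refine h3.trans_eq ?_
  -- By Bernstein the two terms carry m_Ω^(s+1) and m_Ω^(s+2); factoring out (δ m_Ω)^(s+1) leaves 1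
  -- + 4δ m_Ω/π.
  rw [hC, hTilde, mul_pow]
  ring

end BunchedSampling

/-! ### The fusion frame theorem -/

open BunchedSampling in
theorem theorem4p1 {I : Type*} [Countable I] (Ω : Set ℝ) (hΩ : IsCompact Ω) (s : ℕ)
    (x : I → Fin (s + 1) → ℝ) (r : I → ℝ) (δ τ : ℝ) (hτ : τ ∈ Set.Ioc (0 : ℝ) 1)
    (hx : IsBunchedSamplingSet x r δ τ) (hδ : δ * bandwidth Ω < HTilde s τ 1) :
    (∀ (n : I) (g : ℝ → ℂ), bunchInterp x n (bunchInterp x n g) = bunchInterp x n g) ∧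
    ∃ P : I → bandlimited Ω →L[ℂ] L2,
      (∀ (n : I) (f : bandlimited Ω), P n f =ᵐ[volume] bunchInterp x n (pointValue f)) ∧
      HasFusionBounds (fun _ => 1) P
        ((1 - (1 + τ) ^ s * (δ * bandwidth Ω) ^ (s + 1) / ((s + 1).factorial : ℝ) *
          (1 + 4 * (δ * bandwidth Ω) / Real.pi)) ^ 2)
        ((1 + (1 + τ) ^ s * (δ * bandwidth Ω) ^ (s + 1) / ((s + 1).factorial : ℝ) *
          (1 + 4 * (δ * bandwidth Ω) / Real.pi)) ^ 2) ∧
      IsNonorthogonalFusionFrame (fun _ => 1) P := by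
  refine ⟨fun n g => bunchInterp_bunchInterp (hx.node_mem_voronoi n) (hx.node_injective n) g, ?_⟩
  have hop : ∀ n, ∃ P : bandlimited Ω →L[ℂ] L2,
      (∀ f : bandlimited Ω, P f =ᵐ[volume] bunchInterp x n (pointValue f)) ∧
      ∃ Q : L2 →L[ℂ] L2, (∀ g, Q (Q g) = Q g) ∧ IsClosed (range Q) ∧
        ∀ f : bandlimited Ω, Q f = P f := fun n => by
    obtain ⟨a, b, -, hab⟩ := hx.exists_voronoi_eq_Icc n
    exact exists_bunchInterp_operator hΩ hab
  choose P hP hQ using hop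
  set η : ℝ := hTilde s τ (δ * bandwidth Ω) with hη
  have hz : 0 ≤ δ * bandwidth Ω := mul_nonneg hx.density_nonneg (bandwidth_nonneg Ω)
  have hη1 : η < 1 := hTilde_lt_one hτ.1 hz hδ
  have hη0 : 0 ≤ η := by
    have := hτ.1
    have := Real.pi_pos
    rw [hη, hTilde]
    positivity
  have hbounds : HasFusionBounds (fun _ => 1) P ((1 - η) ^ 2) ((1 + η) ^ 2) := by
    intro f
    have hnorm : ∀ n, ‖P n f‖ =
        lpNorm (fun y : ℝ => (interpPoly (x n) (pointValue f)).eval (y : ℂ)) 2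
          (volume.restrict (voronoi (fun k => x k 0) n)) := fun n => by
      obtain ⟨a, b, -, hab⟩ := hx.exists_voronoi_eq_Icc n
      have h := hP n f
      unfold bunchInterp at h
      rw [hab] at h ⊢
      exact norm_eq_lpNorm_restrict
        ((interpPoly (x n) (pointValue f)).continuous.comp Complex.continuous_ofReal) h
    obtain ⟨h1, h2⟩ := sqrt_tsum_lpNorm_sub_le hΩ hτ.1.le hx f.2 hnorm
    rw [← hη, abs_le] at h2
    simp only [one_mul]
    refine ⟨h1, ?_⟩
    have hS : 0 ≤ ∑' n, ‖P n f‖ ^ 2 := tsum_nonneg fun n => sq_nonneg _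
    have hf0 : 0 ≤ ‖(f : L2)‖ := norm_nonneg _
    -- With every term a square, both bounds reduce to |√S - ‖f‖| ≤ η‖f‖; squaring the lower one
    -- requires η ≤ 1, while η < 1 makes its constant positive.
    rw [show ‖f‖ = ‖(f : L2)‖ from rfl, ← Real.sq_sqrt hS, ← mul_pow, ← mul_pow]
    have hlow : 0 ≤ (1 - η) * ‖(f : L2)‖ := mul_nonneg (by linarith) hf0
    constructor
    · refine pow_le_pow_left₀ hlow ?_ 2
      linarith [h2.1]
    · refine pow_le_pow_left₀ (Real.sqrt_nonneg _) ?_ 2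
      linarith [h2.2]
  refine ⟨P, hP, hbounds, fun _ => one_pos, hQ, _, _, ?_, ?_, hbounds⟩
  · exact pow_pos (by linarith) 2
  · positivity
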